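/- Let $G=H_1*\cdots*H_p*F_k$, where the $H_i$ are nontrivial subgroups, $F_k$ is free of rank $k$ and $p+k\ge 2$, and let $\mathcal G=\{[H_1],\dots,[H_p]\}$. A metric simplicial $G$-tree $T$ (with $G$ acting by simplicial isometries) belongs to $\mathcal T_{\mathcal G}$ (whose points are such trees up to homothety) if: no vertex is redundant, i.e. of valence two and such that every element fixing it fixes both incident edges; the action has no global fixed point and there is no proper $G$-invariant subtree; edge stabilizers are trivial and there are finitely many orbits of edges; each conjugate of each $H_i$ fixes a unique vertex; and every vertex stabilizer is either trivial or a conjugate of some $H_i$. Let $\phi:G\to G$ be an injective endomorphism such that * $\phi$ is strictly type-preserving relative to $\mathcal G$: each $\phi(H_i)$ is contained in a conjugate of some $H_j$, and for all $j$ and $g\in G$ the subgroup $\phi^{-1}(gH_jg^{-1})$ is trivial or a conjugate of some $H_i$; * $\phi$ is irreducible relative to $\mathcal G$: whenever $G=B_1*\cdots*B_q*F$ with $B_j\neq 1$ and $F$ free of finite rank, every $H_i$ is conjugate into some $B_j$, and every $\phi(B_j)$ is conjugate into some $B_{j'}$, then either every $B_j$ is conjugate into some $H_i$, or some $B_j$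 equals $G$. A $\mathcal G$-relative weak representative of $\phi$ on $T\in\mathcal T_{\mathcal G}$ is a map $f:T\to T$ with $f(gx)=\phi(g)f(x)$ for $g\in G$, $x\in T$, that sends vertices to vertices and each edge to an edge path without backtracking (possibly a single vertex). Let $e_1,\dots,e_m$ represent the orbits of unoriented edges of $T$, and let $M_f=(a_{ij})$, where $a_{ij}$ is the number of times $f(e_j)$ crosses translates of $e_i$, in either direction; $f$ is $\mathcal G$-irreducible if $M_f$ is an irreducible matrix, i.e. if for all $i,j$ there is $n\ge1$ with $(M_f^n)_{ij}>0$. The gate structure induced by $f$ declares two oriented edges issuing from the same vertex equivalent if their images under $f$ have the same initial edge. A train track structure on $T$ is a $G$-invariant equivalence relation on the set of oriented edges issuing from each vertex, such that there are at least two equivalence classes (gates) at each vertex. Then there exist a tree $T\in\mathcal T_{\mathcal G}$ and a $\mathcal G$-irreducible $\mathcal G$-relative weak representative $f:T\to T$ of $\phi$ such that the gate structure induced by $f$ is a train track structure; in particular every vertex of $T$ has at least two gates. -/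

import Mathlib

universe u

namespace RelTrainTrack

section FreeProducts

variable {G : Type u} [Group G]

/-- The conjugate `g K g⁻¹` of a subgroup. -/
def conj (g : G) (K : Subgroup G) : Subgroup G :=
  K.map (MulAut.conj g).toMonoidHom

/-- `G` is the internal free product `B 0 ∗ ⋯ ∗ B (q-1) ∗ F`, where `F` is free on the
family `x` of `l` elements: the canonical homomorphism from the external free product of the
`B i` and of the free group of rank `l` to `G` is bijective. -/
def IsFreeProduct {q l : ℕ} (B : Fin q → Subgroup G) (x : Fin l → G) : Prop :=
  Function.Bijective
    (Monoid.Coprod.lift (Monoid.CoprodI.lift fun i => (B i).subtype) (FreeGroup.lift x))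

/-- The conjugacy classes of the `B i` form a free factor system of `G`: the `B i` are
nontrivial and `G = B 0 ∗ ⋯ ∗ B (q-1) ∗ F` for some free group `F` of finite rank. -/
def IsFreeFactorSystem {q : ℕ} (B : Fin q → Subgroup G) : Prop :=
  (∀ i, B i ≠ ⊥) ∧ ∃ (l : ℕ) (x : Fin l → G), IsFreeProduct B x

/-- Each `A i` is conjugate into some `B j`. -/
def CarriedBy {p q : ℕ} (A : Fin p → Subgroup G) (B : Fin q → Subgroup G) : Prop :=
  ∀ i, ∃ j g, A i ≤ conj g (B j)

/-- The endomorphism `φ` maps each `B i` into a conjugate of some `B j`. -/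
def IsInvariant {q : ℕ} (φ : G →* G) (B : Fin q → Subgroup G) : Prop :=
  ∀ i, ∃ j g, (B i).map φ ≤ conj g (B j)

/-- `φ` is strictly type-preserving relative to `{[H 0], …, [H (p-1)]}`: each `H i` is mapped
into a conjugate of some `H j`, and the preimage of a conjugate of some `H j` is trivial or
is a conjugate of some `H i`. -/
def IsStrictlyTypePreserving {p : ℕ} (φ : G →* G) (H : Fin p → Subgroup G) : Prop :=
  IsInvariant φ H ∧
    ∀ j g, (conj g (H j)).comap φ = ⊥ ∨ ∃ i g', (conj g (H j)).comap φ = conj g' (H i)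

/-- `φ` is irreducible relative to the free factor system `{[H 0], …, [H (p-1)]}`: the latter
is `φ`-invariant, and there is no `φ`-invariant free factor system lying strictly between it and
the improper free factor system `{[G]}`. -/
def IsIrreducibleRel {p : ℕ} (φ : G →* G) (H : Fin p → Subgroup G) : Prop :=
  IsInvariant φ H ∧
    ∀ (q : ℕ) (B : Fin q → Subgroup G), IsFreeFactorSystem B → CarriedBy H B →
      IsInvariant φ B → CarriedBy B H ∨ ∃ j, B j = ⊤

end FreeProducts

/-- A metric simplicial `G`-tree: a tree with positive edge lengths, on which `G` acts by
length-preserving simplicial automorphisms. -/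
structure MetricGTree (G : Type u) [Group G] where
  V : Type u
  [action : MulAction G V]
  graph : SimpleGraph V
  isTree : graph.IsTree
  adj_smul : ∀ (g : G) (v w : V), graph.Adj v w → graph.Adj (g • v) (g • w)
  length : Sym2 V → ℝ
  length_pos : ∀ e ∈ graph.edgeSet, 0 < length e
  length_smul : ∀ (g : G), ∀ e ∈ graph.edgeSet, length (e.map (g • ·)) = length e

attribute [instance] MetricGTree.action

namespace MetricGTree

variable {G : Type u} [Group G] (T : MetricGTree G)

/-- An oriented edge (a dart) of the tree, from `d.fst` to `d.snd`. -/
abbrev OrientedEdge : Type u := T.graph.Dart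

/-- Two oriented edges are identified if their underlying unoriented edges are in the same
`G`-orbit. -/
def edgeOrbitSetoid : Setoid T.OrientedEdge where
  r d d' := ∃ g : G, d.edge.map (g • ·) = d'.edge
  iseqv :=
    { refl := fun d => ⟨1, by simp⟩
      symm := by
        rintro d d' ⟨g, h⟩
        refine ⟨g⁻¹, ?_⟩
        rw [← h, Sym2.map_map]
        simp
      trans := by
        rintro d d' d'' ⟨g, h⟩ ⟨g', h'⟩
        refine ⟨g' * g, ?_⟩
        rw [← h', ← h, Sym2.map_map]
        congr 1
        ext v
        simp [mul_smul] }

/-- The set of `G`-orbits of unoriented edges of `T`. -/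
def EdgeOrbit : Type u := Quotient T.edgeOrbitSetoid

/-- The orbit of the unoriented edge underlying `d`. -/
def edgeOrbit (d : T.OrientedEdge) : T.EdgeOrbit := Quotient.mk T.edgeOrbitSetoid d

/-- A chosen edge (with an orientation) in each orbit of edges. -/
noncomputable def edgeRep (i : T.EdgeOrbit) : T.OrientedEdge := Quotient.out i

/-- The vertex `v` is fixed by the subgroup `K`. -/
def FixedBy (K : Subgroup G) (v : T.V) : Prop := ∀ h ∈ K, h • v = v

/-- `v` has valence two, and an element fixing `v` fixes every edge incident on `v`. -/
def IsRedundant (v : T.V) : Prop :=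
  (T.graph.neighborSet v).encard = 2 ∧
    ∀ g : G, g • v = v → ∀ w, T.graph.Adj v w → g • w = w

/-- Membership of a metric simplicial `G`-tree in the (unprojectivized) outer space of
`(G, {[H 0], …, [H (p-1)]})`. A point of the projectivized space is the class of such a tree up to
homothety. -/
structure InOuterSpace {p : ℕ} (H : Fin p → Subgroup G) : Prop where
  no_redundant : ∀ v, ¬ T.IsRedundant v
  nontrivial : ¬ ∃ v : T.V, ∀ g : G, g • v = v
  /-- there is no proper `G`-invariant subtree -/
  minimal : ∀ S : Set T.V, (∀ (g : G), ∀ v ∈ S, g • v ∈ S) →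
    (T.graph.induce S).Connected → S = Set.univ
  /-- only the identity maps an unoriented edge to itself -/
  edge_stabilizer : ∀ (d : T.OrientedEdge) (g : G), d.edge.map (g • ·) = d.edge → g = 1
  finite_edgeOrbit : Finite T.EdgeOrbit
  existsUnique_fixed : ∀ i g, ∃! v, T.FixedBy (conj g (H i)) v
  /-- a vertex stabilizer is either trivial (free vertices) or a conjugate of some `H i` -/
  vertex_stabilizer : ∀ v : T.V, MulAction.stabilizer G v = ⊥ ∨
    ∃ i g, MulAction.stabilizer G v = conj g (H i)

/-- A family of relations on the sets of oriented edges issuing from the vertices `v` of `T`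
(an edge at `v` is given by its other endpoint) is a train track structure if it is a
`G`-invariant family of equivalence relations, with at least two classes at each vertex. -/
structure IsTrainTrackStructure
    (r : ∀ v : T.V, T.graph.neighborSet v → T.graph.neighborSet v → Prop) : Prop where
  equivalence : ∀ v, Equivalence (r v)
  smul : ∀ (g : G) (v : T.V) (w w' : T.graph.neighborSet v), r v w w' →
    r (g • v) ⟨g • w.1, T.adj_smul g v w.1 w.2⟩ ⟨g • w'.1, T.adj_smul g v w'.1 w'.2⟩
  two_gates : ∀ v, ∃ w w', ¬ r v w w'

end MetricGTree

/-- A (tight) relative weak representative of `φ` on `T`: a `φ`-equivariant map `T → T` that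
sends vertices to vertices and each edge to an edge path without backtracking, possibly a
single vertex. As paths in a tree are determined by their endpoints, `edgePath` is compatible
with reversal of edges and with the action of `G`. -/
structure WeakRepresentative {G : Type u} [Group G] (T : MetricGTree G) (φ : G →* G) where
  toFun : T.V → T.V
  map_smul : ∀ (g : G) (v : T.V), toFun (g • v) = φ g • toFun v
  edgePath : ∀ {v w : T.V}, T.graph.Adj v w → T.graph.Walk (toFun v) (toFun w)
  tight : ∀ {v w : T.V} (h : T.graph.Adj v w), (edgePath h).IsPath

namespace WeakRepresentative

variable {G : Type u} [Group G] {T : MetricGTree G} {φ : G →* G}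
  (f : WeakRepresentative T φ)

open Classical in
/-- The transition matrix: the entry `(i, j)` is the number of times that the image of the
representative of the `j`-th orbit of edges crosses (in either direction) edges of the `i`-th
orbit. -/
noncomputable def transitionMatrix : Matrix T.EdgeOrbit T.EdgeOrbit ℝ :=
  Matrix.of fun i j =>
    (((f.edgePath (T.edgeRep j).adj).darts.countP fun d => decide (T.edgeOrbit d = i) : ℕ) : ℝ)

/-- `f` is irreducible relative to the free factor system. -/
def IsIrreducible : Prop := f.transitionMatrix.IsIrreducible

/-- The gate structure induced by `f`: two edges at `v` are equivalent if their images, which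
are edge paths issuing from `f v`, have the same initial edge. (The second vertex of a path
determines its initial edge; it is `f v` itself exactly if the path is a single vertex.) -/
def gate (v : T.V) (w w' : T.graph.neighborSet v) : Prop :=
  (f.edgePath w.2).snd = (f.edgePath w'.2).snd

end WeakRepresentative

end RelTrainTrack

/-! Nothing is optimised over outer space: one fixed tree suffices. It is the Bass–Serre tree of a
graph of groups with a single base vertex, an edge to one further vertex for each remaining factor,
and a loop for each free generator. The base group is one of the `H i`, or trivial if there are
none.

On this tree every weak representative is irreducible (`bsTree_isIrreducible`). If a proper nonempty
set of edge orbits were invariant, merging the factors and generators labelled by it into the base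
group would give a `φ`-invariant free factor system (`map_factorSubgroup_le`). It would lie strictly
between the given one and `{[G]}`, which relative irreducibility forbids (`not_isInvariantSet`). In
particular no edge is collapsed.

It remains to find two gates at each vertex. If `p ≥ 1`, all vertex stabilizers are nontrivial. For
`a ≠ 1` fixing `v`, an edge at `v` and its `a`-translate lie in different gates: otherwise `φ a`
would fix an edge, against injectivity (`exists_gates_of_stabilizer`). If `p = 0`, the tree is the
Cayley tree of a free group. The base vertex is sent to a point `u` minimising the total
displacement of the `φ (x j)`; a single gate would let `u` move so as to shorten every displacement
(`exists_weakRepresentative_two_gates`). -/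

namespace RelTrainTrack

/-! ### Free products through their universal property, and merging of factors. -/

section FreeDecomposition

variable {G : Type u} [Group G]

/-- `G` is the free product of the `B i` and of the free group on the `x j`: the universal
property. -/
structure IsFreeDecomposition {ι κ : Type} (B : ι → Subgroup G) (x : κ → G) : Prop where
  exists_lift : ∀ (N : Type u) [Group N] (a : ∀ i, B i →* N) (y : κ → N),
    ∃ F : G →* N, (∀ i (h : B i), F h = a i h) ∧ ∀ j, F (x j) = y j
  eq_top : ∀ K : Subgroup G, (∀ i, B i ≤ K) → (∀ j, x j ∈ K) → K = ⊤

theorem IsFreeProduct.isFreeDecomposition {q l : ℕ} {B : Fin q → Subgroup G} {x : Fin l → G}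
    (h : IsFreeProduct B x) : IsFreeDecomposition B x := by
  set Θ := Monoid.Coprod.lift (Monoid.CoprodI.lift fun i => (B i).subtype) (FreeGroup.lift x)
    with hΘ
  have hB : ∀ i (b : B i), Θ (Monoid.Coprod.inl (Monoid.CoprodI.of b)) = b := by
    intro i b; simp [hΘ]
  have hx : ∀ j, Θ (Monoid.Coprod.inr (FreeGroup.of j)) = x j := by
    intro j; simp [hΘ]
  let e := MulEquiv.ofBijective Θ h
  refine ⟨fun N _ a y => ?_, fun K hBK hxK => ?_⟩
  · refine ⟨(Monoid.Coprod.lift (Monoid.CoprodI.lift a) (FreeGroup.lift y)).comp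
      e.symm.toMonoidHom, fun i b => ?_, fun j => ?_⟩
    · have : e.symm (b : G) =
          Monoid.Coprod.inl (Monoid.CoprodI.of (M := fun i => B i) b) := by
        rw [MulEquiv.symm_apply_eq]; exact (hB i b).symm
      simp [this]
    · have : e.symm (x j) = Monoid.Coprod.inr (FreeGroup.of j) := by
        rw [MulEquiv.symm_apply_eq]; exact (hx j).symm
      simp [this]
  · rw [eq_top_iff]
    rintro g -
    obtain ⟨w, rfl⟩ := h.2 g
    change w ∈ K.comap Θ
    induction w using Monoid.Coprod.induction_on with
    | inl m =>
      induction m using Monoid.CoprodI.induction_on with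
      | one => simp
      | of i m => exact hBK i (by rw [hB]; exact m.2)
      | mul a b ha hb => rw [map_mul]; exact mul_mem ha hb
    | inr m =>
      induction m using FreeGroup.induction_on with
      | C1 => simp
      | of j => change Θ _ ∈ K; rw [hx]; exact hxK j
      | inv_of j hj => rw [map_inv]; exact inv_mem hj
      | mul a b ha hb => rw [map_mul]; exact mul_mem ha hb
    | mul a b ha hb => exact mul_mem ha hb

theorem IsFreeDecomposition.isFreeProduct {q l : ℕ} {B : Fin q → Subgroup G} {x : Fin l → G}
    (h : IsFreeDecomposition B x) : IsFreeProduct B x := by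
  set Θ := Monoid.Coprod.lift (Monoid.CoprodI.lift fun i => (B i).subtype) (FreeGroup.lift x)
    with hΘ
  obtain ⟨F, hFB, hFx⟩ := h.exists_lift
    (Monoid.Coprod (Monoid.CoprodI fun i => B i) (FreeGroup (Fin l)))
    (fun i => Monoid.Coprod.inl.comp (Monoid.CoprodI.of (M := fun i => B i)))
    (fun j => Monoid.Coprod.inr (FreeGroup.of j))
  have hinv : F.comp Θ = MonoidHom.id _ := by
    refine Monoid.Coprod.hom_ext ?_ ?_
    · refine Monoid.CoprodI.ext_hom _ _ fun i => ?_
      ext b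
      simp [hΘ, hFB]
    · ext j
      simp [hΘ, hFx]
  refine ⟨fun a b hab => ?_, ?_⟩
  · have := congrArg F hab
    have h' := DFunLike.congr_fun hinv
    exact (h' a).symm.trans (this.trans (h' b))
  · rw [← MonoidHom.range_eq_top]
    refine h.eq_top _ (fun i b hb => ⟨Monoid.Coprod.inl (Monoid.CoprodI.of (⟨b, hb⟩ : B i)), ?_⟩)
      fun j => ⟨Monoid.Coprod.inr (FreeGroup.of j), ?_⟩ <;> simp

theorem IsFreeDecomposition.reindex {ι κ ι' κ' : Type} {B : ι → Subgroup G} {x : κ → G}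
    (h : IsFreeDecomposition B x) (e : ι' ≃ ι) (e' : κ' ≃ κ) :
    IsFreeDecomposition (B ∘ e) (x ∘ e') := by
  refine ⟨fun N _ a y => ?_, fun K hB hx => h.eq_top K (fun i => ?_) fun j => ?_⟩
  · obtain ⟨F, hFB, hFx⟩ := h.exists_lift N
      (fun i => (a (e.symm i)).comp (Subgroup.inclusion (by simp))) (fun j => y (e'.symm j))
    refine ⟨F, fun i b => ?_, fun j => by simp [hFx]⟩
    have key : ∀ i₀ (hi : i₀ = i) (hle : B (e i) ≤ (B ∘ e) i₀),
        a i₀ (Subgroup.inclusion hle b) = a i b := by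
      rintro _ rfl _; rfl
    exact (hFB (e i) b).trans (key _ (by simp) _)
  · simpa using hB (e.symm i)
  · simpa using hx (e'.symm j)

/-- Without factors, a trivial one serves as base group, so that the same tree construction covers
free groups. -/
theorem IsFreeDecomposition.extend_bot {κ : Type} {B : Fin 0 → Subgroup G} {x : κ → G}
    (h : IsFreeDecomposition B x) :
    IsFreeDecomposition (fun _ : Option (Fin 0) => (⊥ : Subgroup G)) x := by
  refine ⟨fun N _ a y => ?_, fun K _ hx => h.eq_top K (fun i => i.elim0) hx⟩
  obtain ⟨F, -, hFx⟩ := h.exists_lift N (fun i => i.elim0) y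
  refine ⟨F, fun i b => ?_, hFx⟩
  obtain rfl : b = 1 := Subsingleton.elim _ _
  simp

/-- The subgroup generated by the base factor and by the factors and free generators with label
in `S`. -/
def factorSubgroup {I J : Type} (L : Option I → Subgroup G) (x : J → G) (S : Set (I ⊕ J)) :
    Subgroup G :=
  L none ⊔ (⨆ i : {i // Sum.inl i ∈ S}, L (some i)) ⊔
    Subgroup.closure (x '' {j | Sum.inr j ∈ S})

section factorSubgroup

variable {I J : Type} {L : Option I → Subgroup G} {x : J → G} {S : Set (I ⊕ J)}

theorem none_le_factorSubgroup : L none ≤ factorSubgroup L x S :=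
  le_sup_left.trans le_sup_left

theorem some_le_factorSubgroup {i : I} (hi : Sum.inl i ∈ S) :
    L (some i) ≤ factorSubgroup L x S :=
  ((le_iSup (fun i : {i // Sum.inl i ∈ S} => L (some i)) ⟨i, hi⟩).trans le_sup_right).trans
    le_sup_left

theorem mem_factorSubgroup {j : J} (hj : Sum.inr j ∈ S) : x j ∈ factorSubgroup L x S :=
  le_sup_right (a := L none ⊔ _) (Subgroup.subset_closure ⟨j, hj, rfl⟩)

theorem factorSubgroup_le {K : Subgroup G} (h0 : L none ≤ K)
    (hI : ∀ i, Sum.inl i ∈ S → L (some i) ≤ K) (hJ : ∀ j, Sum.inr j ∈ S → x j ∈ K) :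
    factorSubgroup L x S ≤ K := by
  refine sup_le (sup_le h0 (iSup_le fun i => hI i i.2)) ?_
  rw [Subgroup.closure_le]
  rintro _ ⟨j, hj, rfl⟩
  exact hJ j hj

/-- The factors of the decomposition obtained by merging all factors with label in `S` with the
base factor. -/
def mergedFactors (L : Option I → Subgroup G) (x : J → G) (S : Set (I ⊕ J)) :
    Option {i : I // Sum.inl i ∉ S} → Subgroup G
  | none => factorSubgroup L x S
  | some i => L (some i)

/-- Associativity of free products. A homomorphism prescribed on the merged factor restricts to the
pieces of that factor, lifts from there, and agrees with the prescription on generators. -/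
theorem IsFreeDecomposition.merge (h : IsFreeDecomposition L x) (S : Set (I ⊕ J)) :
    IsFreeDecomposition (mergedFactors L x S) (fun j : {j : J // Sum.inr j ∉ S} => x j) := by
  classical
  refine ⟨fun N _ a y => ?_, fun K hB hx => h.eq_top K (fun o => ?_) fun j => ?_⟩
  · let b : ∀ o : Option I, L o →* N := fun o => match o with
      | none => (a none).comp (Subgroup.inclusion none_le_factorSubgroup)
      | some i => if hi : Sum.inl i ∈ S then
          (a none).comp (Subgroup.inclusion (some_le_factorSubgroup hi)) else a (some ⟨i, hi⟩)
    let z : J → N := fun j =>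
      if hj : Sum.inr j ∈ S then a none ⟨x j, mem_factorSubgroup hj⟩ else y ⟨j, hj⟩
    obtain ⟨F, hFB, hFx⟩ := h.exists_lift N b z
    refine ⟨F, fun o => ?_, fun j => by simp [hFx, z, j.2]⟩
    match o with
    | some ⟨i, hi⟩ =>
      intro g
      have := hFB (some i) g
      rwa [show b (some i) = a (some ⟨i, hi⟩) from dif_neg hi] at this
    | none =>
      rintro ⟨g, hg⟩
      -- The locus where the lift agrees with `a none` is a subgroup, so it is enough that it
      -- contains the generating pieces.
      have hle : factorSubgroup L x S ≤ ((F.comp (factorSubgroup L x S).subtype).eqLocus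
          (a none)).map (factorSubgroup L x S).subtype := by
        refine factorSubgroup_le (fun g hg => ?_) (fun i hi g hg => ?_) fun j hj => ?_
        · exact ⟨⟨g, none_le_factorSubgroup hg⟩, hFB none ⟨g, hg⟩, rfl⟩
        · refine ⟨⟨g, some_le_factorSubgroup hi hg⟩, ?_, rfl⟩
          have := hFB (some i) ⟨g, hg⟩
          rwa [show b (some i) = (a none).comp (Subgroup.inclusion (some_le_factorSubgroup hi))
            from dif_pos hi] at this
        · refine ⟨⟨x j, mem_factorSubgroup hj⟩, ?_, rfl⟩
          have := hFx j
          simp only [z, hj, dif_pos] at this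
          exact this
      obtain ⟨⟨g', _⟩, h1, rfl⟩ := hle hg
      exact h1
  · match o with
    | none => exact none_le_factorSubgroup.trans (hB none)
    | some i =>
      by_cases hi : Sum.inl i ∈ S
      · exact (some_le_factorSubgroup hi).trans (hB none)
      · exact hB (some ⟨i, hi⟩)
  · by_cases hj : Sum.inr j ∈ S
    · exact hB none (mem_factorSubgroup hj)
    · exact hx ⟨j, hj⟩

end factorSubgroup

end FreeDecomposition

/-! ### The Bass–Serre graph and its edge-counting potential. -/

section BassSerre

variable {G : Type u} [Group G] {I J : Type} (L : Option I → Subgroup G) (x : J → G)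

/-- The vertices of the Bass–Serre tree: the cosets of the factors. -/
abbrev BSVertex : Type u := Σ o : Option I, G ⧸ L o

/-- The coset `g L o` as a vertex. -/
def vtx (o : Option I) (g : G) : BSVertex L := ⟨o, (g : G ⧸ L o)⟩

variable {L} in
theorem exists_eq_vtx (v : BSVertex L) : ∃ o g, v = vtx L o g := by
  obtain ⟨o, c⟩ := v
  obtain ⟨g, rfl⟩ := QuotientGroup.mk_surjective c
  exact ⟨o, g, rfl⟩

theorem smul_vtx (g : G) (o : Option I) (h : G) : g • vtx L o h = vtx L o (g * h) := rfl

theorem vtx_eq_iff {o : Option I} {g h : G} : vtx L o g = vtx L o h ↔ g⁻¹ * h ∈ L o := by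
  rw [← QuotientGroup.eq]
  simp [vtx]

theorem mem_conj_iff {g a : G} {K : Subgroup G} : a ∈ conj g K ↔ g⁻¹ * a * g ∈ K := by
  constructor
  · rintro ⟨k, hk, rfl⟩
    simpa [mul_assoc] using hk
  · intro h
    exact ⟨_, h, by simp [mul_assoc]⟩

theorem stabilizer_vtx (o : Option I) (g : G) :
    MulAction.stabilizer G (vtx L o g) = conj g (L o) := by
  ext a
  rw [MulAction.mem_stabilizer_iff, smul_vtx, eq_comm, vtx_eq_iff, mem_conj_iff, mul_assoc]

/-- The terminal vertex of the edge with label `e` issuing from the vertex `g L none`. -/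
def tgt (g : G) : I ⊕ J → BSVertex L
  | Sum.inl i => vtx L (some i) g
  | Sum.inr j => vtx L none (g * x j)

theorem smul_tgt (g h : G) (e : I ⊕ J) : g • tgt L x h e = tgt L x (g * h) e := by
  cases e with
  | inl i => rfl
  | inr j => simp [tgt, smul_vtx, mul_assoc]

/-- The Bass–Serre graph. -/
def bsGraph : SimpleGraph (BSVertex L) :=
  SimpleGraph.fromRel fun v w => ∃ g e, v = vtx L none g ∧ w = tgt L x g e

/-- The left translation action of `G` on integral functions on the edges. -/
def translate (E : Type) : G →* Equiv.Perm (G × E → ℤ) where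
  toFun g :=
    { toFun := fun m q => m (g⁻¹ * q.1, q.2)
      invFun := fun m q => m (g * q.1, q.2)
      left_inv := fun m => by simp
      right_inv := fun m => by simp }
  map_one' := by ext; simp
  map_mul' g h := by ext; simp [mul_assoc]

theorem translate_apply {E : Type} (g : G) (m : G × E → ℤ) (q : G × E) :
    translate E g m q = m (g⁻¹ * q.1, q.2) := rfl

theorem translate_single {E : Type} [DecidableEq (G × E)] (g h : G) (e : E) :
    translate E g (Pi.single (h, e) 1) = Pi.single (g * h, e) 1 := by
  ext ⟨a, e'⟩
  rw [translate_apply, Pi.single_apply, Pi.single_apply]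
  exact if_congr (by simp [inv_mul_eq_iff_eq_mul]) rfl rfl

variable {L x}

open Classical in
/-- Fox calculus: there is a function on the vertices whose coboundary is the tautological
function on the edges. -/
theorem IsFreeDecomposition.exists_potential (h : IsFreeDecomposition L x) :
    ∃ P : BSVertex L → G × (I ⊕ J) → ℤ,
      ∀ g e, P (tgt L x g e) = P (vtx L none g) + Pi.single (g, e) 1 := by
  let s : I ⊕ J → G × (I ⊕ J) → ℤ := fun e => Pi.single (1, e) 1
  let c : Option I → G × (I ⊕ J) → ℤ := fun o => o.elim 0 fun i => s (Sum.inl i)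
  -- An affine action of `G` with linear part `translate`: `L o` acts linearly about the centre `c
  -- o`, and `x j` acts by `translate` followed by adding the basis vector `s (Sum.inr j)`. The
  -- vertex `g L o` will be placed at `α g (c o)`.
  obtain ⟨α, hαB, hαx⟩ := h.exists_lift (Equiv.Perm (G × (I ⊕ J) → ℤ))
    (fun o => ((MulAut.conj (Equiv.addRight (c o))).toMonoidHom.comp (translate (I ⊕ J))).comp
      (L o).subtype)
    (fun j => Equiv.addRight (s (Sum.inr j)) * translate (I ⊕ J) (x j))
  have hαB' : ∀ o, ∀ g ∈ L o, ∀ m, α g m = translate _ g (m - c o) + c o := by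
    intro o g hg m
    rw [hαB o ⟨g, hg⟩]
    simp [MulAut.conj_apply, sub_eq_add_neg]
  have hαx' : ∀ j m, α (x j) m = translate _ (x j) m + s (Sum.inr j) := by
    intro j m
    rw [hαx]
    simp
  have hsub : ∀ (g : G) (m n : G × (I ⊕ J) → ℤ),
      translate _ g (m - n) = translate _ g m - translate _ g n := fun g m n => rfl
  let K : Subgroup G :=
    { carrier := {g | ∀ m n, α g m - α g n = translate _ g (m - n)}
      one_mem' := fun m n => by simp
      mul_mem' := fun {a b} ha hb m n => by
        simp only [map_mul, Equiv.Perm.mul_apply]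
        rw [ha, hb]
      inv_mem' := fun {a} ha m n => by
        have := ha (α a⁻¹ m) (α a⁻¹ n)
        rw [← Equiv.Perm.mul_apply, ← Equiv.Perm.mul_apply, ← map_mul, mul_inv_cancel, map_one,
          Equiv.Perm.one_apply, Equiv.Perm.one_apply] at this
        rw [this, ← Equiv.Perm.mul_apply, ← map_mul, inv_mul_cancel, map_one,
          Equiv.Perm.one_apply] }
  -- The elements acting with the expected linear part form a subgroup containing all generators.
  have hK : K = ⊤ := by
    refine h.eq_top K (fun o g hg m n => ?_) fun j m n => ?_
    · rw [hαB' o g hg, hαB' o g hg]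
      simp only [hsub]
      abel
    · rw [hαx', hαx', hsub]
      abel
  have hlin : ∀ g m n, α g m = α g n + translate _ g (m - n) := fun g m n => by
    have : g ∈ K := hK ▸ Subgroup.mem_top g
    rw [← this m n]
    abel
  have hfix : ∀ o, ∀ g ∈ L o, α g (c o) = c o := by
    intro o g hg
    have h0 : translate (I ⊕ J) g 0 = 0 := rfl
    rw [hαB' o g hg, sub_self, h0, zero_add]
  have hwd : ∀ o (a b : G), (QuotientGroup.leftRel (L o)) a b → α a (c o) = α b (c o) := by
    intro o a b hab
    rw [QuotientGroup.leftRel_apply] at hab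
    have := hfix o _ hab
    rw [map_mul, Equiv.Perm.mul_apply, map_inv, Equiv.Perm.inv_eq_iff_eq] at this
    exact this.symm
  refine ⟨fun v => Quotient.lift (fun g => α g (c v.1)) (hwd v.1) v.2, fun g e => ?_⟩
  cases e with
  | inl i =>
    change α g (s (Sum.inl i)) = α g 0 + _
    rw [hlin g (s (Sum.inl i)) 0, sub_zero, translate_single, mul_one]
  | inr j =>
    change α (g * x j) 0 = α g 0 + _
    have h0 : translate (I ⊕ J) (x j) 0 = 0 := rfl
    rw [map_mul, Equiv.Perm.mul_apply, hαx', h0, zero_add, hlin g (s (Sum.inr j)) 0, sub_zero,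
      translate_single, mul_one]

end BassSerre

/-! ### The Bass–Serre graph is a tree with trivial edge stabilizers. -/

section Tree

variable {G : Type u} [Group G] {I J : Type} {L : Option I → Subgroup G} {x : J → G}

theorem IsFreeDecomposition.vtx_ne_tgt (h : IsFreeDecomposition L x) (g : G) (e : I ⊕ J) :
    vtx L none g ≠ tgt L x g e := by
  classical
  obtain ⟨P, hP⟩ := h.exists_potential
  intro heq
  have := congrFun (hP g e) (g, e)
  rw [← heq] at this
  simp at this

theorem IsFreeDecomposition.adj_iff (h : IsFreeDecomposition L x) {v w : BSVertex L} :
    (bsGraph L x).Adj v w ↔ ∃ g e, s(v, w) = s(vtx L none g, tgt L x g e) := by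
  simp only [bsGraph, SimpleGraph.fromRel_adj, Sym2.eq_iff]
  constructor
  · rintro ⟨-, ⟨g, e, h1, h2⟩ | ⟨g, e, h1, h2⟩⟩
    · exact ⟨g, e, Or.inl ⟨h1, h2⟩⟩
    · exact ⟨g, e, Or.inr ⟨h2, h1⟩⟩
  · rintro ⟨g, e, ⟨rfl, rfl⟩ | ⟨rfl, rfl⟩⟩
    · exact ⟨h.vtx_ne_tgt g e, Or.inl ⟨g, e, rfl, rfl⟩⟩
    · exact ⟨(h.vtx_ne_tgt g e).symm, Or.inr ⟨g, e, rfl, rfl⟩⟩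

theorem IsFreeDecomposition.adj_tgt (h : IsFreeDecomposition L x) (g : G) (e : I ⊕ J) :
    (bsGraph L x).Adj (vtx L none g) (tgt L x g e) :=
  h.adj_iff.2 ⟨g, e, rfl⟩

/-- The coordinate `(g, e)` of the potential jumps only across edges labelled `(g, e)`. This also
excludes loops carrying two labels and, later, inversions. -/
theorem IsFreeDecomposition.label_unique (h : IsFreeDecomposition L x) {g g' : G}
    {e e' : I ⊕ J} (heq : s(vtx L none g, tgt L x g e) = s(vtx L none g', tgt L x g' e')) :
    g = g' ∧ e = e' := by
  classical
  obtain ⟨P, hP⟩ := h.exists_potential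
  by_contra hne
  have hne' : (g, e) ≠ (g', e') := fun h => hne (by simpa using h)
  have h1 := congrFun (hP g e) (g, e)
  have h2 := congrFun (hP g' e') (g, e)
  simp only [Pi.add_apply, Pi.single_eq_same, Pi.single_eq_of_ne hne'] at h1 h2
  rw [Sym2.eq_iff] at heq
  rcases heq with ⟨h3, h4⟩ | ⟨h3, h4⟩ <;> rw [h3, h4] at h1 <;> omega

/-- Every edge is a bridge: once the edge labelled `(g, e)` is removed, the coordinate `(g, e)` of
the potential is constant along walks, yet it differs at the two ends. -/
theorem IsFreeDecomposition.isAcyclic (h : IsFreeDecomposition L x) :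
    (bsGraph L x).IsAcyclic := by
  classical
  obtain ⟨P, hP⟩ := h.exists_potential
  rw [SimpleGraph.isAcyclic_iff_forall_isBridge]
  intro ε hε
  obtain ⟨g, e, rfl⟩ : ∃ g e, ε = s(vtx L none g, tgt L x g e) := by
    induction ε with | _ v w => exact h.adj_iff.1 hε
  rw [SimpleGraph.isBridge_iff]
  rintro ⟨p⟩
  have hconst : ∀ {v w : BSVertex L},
      ((bsGraph L x).deleteEdges {s(vtx L none g, tgt L x g e)}).Walk v w →
        P v (g, e) = P w (g, e) := by
    intro v w p
    induction p with
    | nil => rfl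
    | @cons v v' w hvv' p ih =>
      rw [← ih]
      rw [SimpleGraph.deleteEdges_adj] at hvv'
      obtain ⟨hadj, hne⟩ := hvv'
      obtain ⟨g', e', heq⟩ := h.adj_iff.1 hadj
      have hne' : (g, e) ≠ (g', e') := by
        rintro ⟨⟩
        exact hne heq
      have h2 := congrFun (hP g' e') (g, e)
      simp only [Pi.add_apply, Pi.single_eq_of_ne hne', add_zero] at h2
      rw [Sym2.eq_iff] at heq
      rcases heq with ⟨h3, h4⟩ | ⟨h3, h4⟩ <;> rw [h3, h4, h2]
  have h1 := congrFun (hP g e) (g, e)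
  rw [← hconst p] at h1
  simp at h1

theorem IsFreeDecomposition.adj_smul (h : IsFreeDecomposition L x) (g : G) (v w : BSVertex L)
    (hvw : (bsGraph L x).Adj v w) : (bsGraph L x).Adj (g • v) (g • w) := by
  obtain ⟨g', e, heq⟩ := h.adj_iff.1 hvw
  refine h.adj_iff.2 ⟨g * g', e, ?_⟩
  rw [← smul_tgt, ← smul_vtx]
  simpa using congrArg (Sym2.map (g • ·)) heq

/-- The `g` for which the base vertex is joined to its `g`-translate form a subgroup containing all
generators. -/
theorem IsFreeDecomposition.connected (h : IsFreeDecomposition L x) :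
    (bsGraph L x).Connected := by
  have hsmul : ∀ (g : G) {v w}, (bsGraph L x).Reachable v w →
      (bsGraph L x).Reachable (g • v) (g • w) := by
    rintro g v w ⟨p⟩
    exact ⟨p.map ⟨(g • ·), h.adj_smul g _ _⟩⟩
  let K : Subgroup G :=
    { carrier := {g | (bsGraph L x).Reachable (vtx L none 1) (vtx L none g)}
      one_mem' := SimpleGraph.Reachable.refl _
      mul_mem' := fun {a b} ha hb => by
        have := hsmul a hb
        rw [smul_vtx, smul_vtx, mul_one] at this
        exact SimpleGraph.Reachable.trans ha this
      inv_mem' := fun {a} ha => by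
        have := hsmul a⁻¹ ha
        rw [smul_vtx, smul_vtx, mul_one, inv_mul_cancel] at this
        exact this.symm }
  have hK : K = ⊤ := by
    refine h.eq_top K (fun o g hg => ?_) fun j => ?_
    · match o with
      | none =>
        have : vtx L none 1 = vtx L none g := (vtx_eq_iff L).2 (by simpa using hg)
        change SimpleGraph.Reachable _ _ _
        rw [← this]
      | some i =>
        have h1 := (h.adj_tgt 1 (Sum.inl i)).reachable
        have h2 := (h.adj_tgt g (Sum.inl i)).reachable
        have : tgt L x 1 (Sum.inl i) = tgt L x g (Sum.inl i) :=
          (vtx_eq_iff L).2 (by simpa using hg)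
        rw [this] at h1
        exact h1.trans h2.symm
    · have := (h.adj_tgt 1 (Sum.inr j)).reachable
      rw [tgt, one_mul] at this
      exact this
  have hall : ∀ v, (bsGraph L x).Reachable (vtx L none 1) v := by
    intro v
    obtain ⟨o, g, rfl⟩ := exists_eq_vtx v
    have hg : g ∈ K := hK ▸ Subgroup.mem_top g
    match o with
    | none => exact hg
    | some i => exact SimpleGraph.Reachable.trans hg (h.adj_tgt g (Sum.inl i)).reachable
  exact { preconnected := fun v w => (hall v).symm.trans (hall w)
          nonempty := ⟨vtx L none 1⟩ }

/-- The Bass–Serre tree of a free decomposition, with edges of length one. -/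
def bsTree (h : IsFreeDecomposition L x) : MetricGTree G where
  V := BSVertex L
  graph := bsGraph L x
  isTree := ⟨h.connected, h.isAcyclic⟩
  adj_smul := h.adj_smul
  length := fun _ => 1
  length_pos := fun _ _ => one_pos
  length_smul := fun _ _ _ => rfl

theorem bsTree_edge_stabilizer (h : IsFreeDecomposition L x) (d : (bsTree h).OrientedEdge) (g : G)
    (hg : d.edge.map (g • ·) = d.edge) : g = 1 := by
  obtain ⟨g', e, heq⟩ := h.adj_iff.1 d.adj
  change d.edge = s(vtx L none g', tgt L x g' e) at heq
  rw [heq] at hg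
  have : s(vtx L none (g * g'), tgt L x (g * g') e) = s(vtx L none g', tgt L x g' e) := by
    rw [← smul_tgt, ← smul_vtx]
    exact hg
  simpa using (h.label_unique this).1

end Tree

/-! ### Geodesics and actions with trivial edge stabilizers. -/

namespace MetricGTree

variable {G : Type u} [Group G] (T : MetricGTree G)

/-- The unique path between two vertices. -/
noncomputable def geodesic (a b : T.V) : T.graph.Walk a b :=
  (T.isTree.existsUnique_path a b).choose

theorem geodesic_isPath (a b : T.V) : (T.geodesic a b).IsPath :=
  (T.isTree.existsUnique_path a b).choose_spec.1

variable {T} in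
theorem eq_geodesic {a b : T.V} {p : T.graph.Walk a b} (hp : p.IsPath) : p = T.geodesic a b :=
  (T.isTree.existsUnique_path a b).choose_spec.2 p hp

/-- The action of an element of the group as a graph homomorphism. -/
def smulHom (g : G) : T.graph →g T.graph := ⟨(g • ·), T.adj_smul g _ _⟩

theorem map_geodesic (g : G) (a b : T.V) :
    (T.geodesic a b).map (T.smulHom g) = T.geodesic (g • a) (g • b) :=
  eq_geodesic ((T.geodesic_isPath a b).map (MulAction.injective g))

/-- The second vertex of the path from `a` to `b`. -/
noncomputable def next (a b : T.V) : T.V := (T.geodesic a b).snd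

theorem next_smul (g : G) (a b : T.V) : T.next (g • a) (g • b) = g • T.next a b := by
  rw [next, ← map_geodesic]
  exact SimpleGraph.Walk.getVert_map _ _ _

theorem adj_next {a b : T.V} (hab : a ≠ b) : T.graph.Adj a (T.next a b) :=
  SimpleGraph.Walk.adj_snd (SimpleGraph.Walk.not_nil_of_ne hab)

/-- Only the identity stabilizes an edge. -/
def FreeOnEdges : Prop := ∀ (d : T.OrientedEdge) (g : G), d.edge.map (g • ·) = d.edge → g = 1

variable {T}

theorem FreeOnEdges.eq_one (hT : T.FreeOnEdges) {g : G} {a b : T.V} (hab : a ≠ b)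
    (ha : g • a = a) (hb : g • b = b) : g = 1 := by
  have hn : g • T.next a b = T.next a b := by rw [← next_smul, ha, hb]
  refine hT ⟨(a, T.next a b), T.adj_next hab⟩ g ?_
  simp [SimpleGraph.Dart.edge, ha, hn]

theorem FreeOnEdges.not_isRedundant (hT : T.FreeOnEdges) {v w : T.V} (hvw : T.graph.Adj v w)
    (hv : MulAction.stabilizer G v ≠ ⊥) : ¬ T.IsRedundant v := by
  rintro ⟨-, hred⟩
  obtain ⟨g, hg, hg1⟩ := (Subgroup.bot_or_exists_ne_one _).resolve_left hv
  exact hg1 (hT.eq_one hvw.ne hg (hred g hg w hvw))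

/-- A connected set of vertices containing two neighbours of `v` contains `v`. -/
theorem mem_of_adj_adj {S : Set T.V} (hS : (T.graph.induce S).Connected) {a v b : T.V}
    (ha : a ∈ S) (hb : b ∈ S) (hav : T.graph.Adj a v) (hvb : T.graph.Adj v b) (hab : a ≠ b) :
    v ∈ S := by
  classical
  obtain ⟨p⟩ := hS.preconnected ⟨a, ha⟩ ⟨b, hb⟩
  have hpath : ∀ q : T.graph.Walk a b, q.IsPath → v ∈ q.support := by
    intro q hq
    have : q = SimpleGraph.Walk.cons hav (SimpleGraph.Walk.cons hvb SimpleGraph.Walk.nil) := by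
      rw [eq_geodesic hq]
      refine (eq_geodesic ?_).symm
      simp [SimpleGraph.Walk.isPath_def, hab, hav.ne, hvb.ne]
    rw [this]
    simp
  have hv := hpath _ (SimpleGraph.Walk.bypass_isPath
    (p.map (SimpleGraph.Embedding.induce S).toHom))
  have hv' := SimpleGraph.Walk.support_bypass_subset_support _ hv
  obtain ⟨s, -, rfl⟩ := List.mem_map.1 ((congrArg (v ∈ ·)
    (SimpleGraph.Walk.support_map (SimpleGraph.Embedding.induce S).toHom p)).mp hv')
  exact s.2

end MetricGTree

/-! ### The Bass–Serre tree lies in outer space. -/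

section OuterSpace

variable {G : Type u} [Group G] {I J : Type} {L : Option I → Subgroup G} {x : J → G}

/-- The base factor is nontrivial, or `G` is free on at least two of the `x j`. -/
structure IsNondegenerate (L : Option I → Subgroup G) (J : Type) : Prop where
  some_ne_bot : ∀ i, L (some i) ≠ ⊥
  base : L none ≠ ⊥ ∧ Nonempty (I ⊕ J) ∨ L none = ⊥ ∧ IsEmpty I ∧ Nontrivial J

theorem IsNondegenerate.nonempty (hL : IsNondegenerate L J) : Nonempty (I ⊕ J) := by
  rcases hL.base with ⟨-, h⟩ | ⟨-, -, h⟩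
  · exact h
  · exact ⟨Sum.inr (Classical.arbitrary J)⟩

/-- The factors of the two families which are nontrivial are the same. -/
structure SameFactors {p : ℕ} (L : Option I → Subgroup G) (H : Fin p → Subgroup G) : Prop where
  exists_eq : ∀ i, ∃ o, H i = L o
  eq_bot_or : ∀ o, L o = ⊥ ∨ ∃ i, H i = L o

theorem conj_ne_bot {g : G} {K : Subgroup G} (hK : K ≠ ⊥) : conj g K ≠ ⊥ := by
  rwa [conj, Ne, Subgroup.map_eq_bot_iff_of_injective _ (MulAut.conj g).injective]

theorem conj_mono {g : G} {K K' : Subgroup G} (hK : K ≤ K') : conj g K ≤ conj g K' :=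
  Subgroup.map_mono hK

theorem conj_bot (g : G) : conj g (⊥ : Subgroup G) = ⊥ := Subgroup.map_bot _

theorem bsTree_freeOnEdges (h : IsFreeDecomposition L x) : (bsTree h).FreeOnEdges :=
  bsTree_edge_stabilizer h

/-- The nontrivial group `L none` fixes only the base vertex, and any label in `S` supplies an
element moving that vertex. -/
theorem IsFreeDecomposition.not_fixed (h : IsFreeDecomposition L x)
    (hI : ∀ i, L (some i) ≠ ⊥) (h0 : L none ≠ ⊥) {S : Set (I ⊕ J)} (hS : S.Nonempty)
    (v : BSVertex L) : ¬ ∀ g ∈ factorSubgroup L x S, g • v = v := by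
  intro hv
  obtain ⟨a, ha, ha1⟩ := (Subgroup.bot_or_exists_ne_one _).resolve_left h0
  have hfix : ∀ o, ∀ a ∈ L o, a • vtx L o 1 = vtx L o 1 := by
    intro o a ha
    rw [← MulAction.mem_stabilizer_iff, stabilizer_vtx, mem_conj_iff]
    simpa using ha
  have hv0 : v = vtx L none 1 := by
    by_contra hne
    exact ha1 ((bsTree_freeOnEdges h).eq_one (a := v) (b := vtx L none 1) hne
      (hv a (none_le_factorSubgroup ha)) (hfix none a ha))
  subst hv0
  obtain ⟨e, he⟩ := hS
  cases e with
  | inl i =>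
    obtain ⟨b, hb, hb1⟩ := (Subgroup.bot_or_exists_ne_one _).resolve_left (hI i)
    exact hb1 ((bsTree_freeOnEdges h).eq_one (a := vtx L none 1) (b := vtx L (some i) 1)
      (h.vtx_ne_tgt 1 (Sum.inl i)) (hv b (some_le_factorSubgroup he hb)) (hfix _ b hb))
  | inr j =>
    have := hv _ (mem_factorSubgroup he)
    rw [smul_vtx] at this
    refine h.vtx_ne_tgt 1 (Sum.inr j) ?_
    rw [tgt, one_mul, ← this, mul_one]

theorem IsFreeDecomposition.no_global_fixed (h : IsFreeDecomposition L x)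
    (hL : IsNondegenerate L J) : ¬ ∃ v : BSVertex L, ∀ g : G, g • v = v := by
  rintro ⟨v, hv⟩
  rcases hL.base with ⟨h0, ⟨e⟩⟩ | ⟨-, hI, hJ⟩
  · exact h.not_fixed hL.some_ne_bot h0 (S := {e}) ⟨e, rfl⟩ v fun g _ => hv g
  · obtain ⟨o, g, rfl⟩ := exists_eq_vtx v
    match o with
    | some i => exact hI.elim i
    | none =>
      let j := Classical.arbitrary J
      refine h.vtx_ne_tgt g (Sum.inr j) ?_
      have := hv (g * x j * g⁻¹)
      rw [smul_vtx] at this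
      rw [tgt, ← this]
      simp

theorem IsFreeDecomposition.exists_adj (h : IsFreeDecomposition L x)
    (hE : Nonempty (I ⊕ J)) (v : BSVertex L) : ∃ w, (bsGraph L x).Adj v w := by
  obtain ⟨o, g, rfl⟩ := exists_eq_vtx v
  match o with
  | none => exact ⟨_, h.adj_tgt g hE.some⟩
  | some i => exact ⟨_, (h.adj_tgt g (Sum.inl i)).symm⟩

theorem IsFreeDecomposition.vtx_eq_of_fixed (h : IsFreeDecomposition L x) {o : Option I} {g : G}
    (ho : L o ≠ ⊥) {v : BSVertex L} (hv : ∀ a ∈ conj g (L o), a • v = v) : v = vtx L o g := by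
  obtain ⟨a, ha, ha1⟩ := (Subgroup.bot_or_exists_ne_one _).resolve_left (conj_ne_bot (g := g) ho)
  by_contra hne
  refine ha1 ((bsTree_freeOnEdges h).eq_one (a := v) (b := vtx L o g) hne (hv a ha) ?_)
  rwa [← stabilizer_vtx] at ha

theorem bsTree_not_isRedundant (h : IsFreeDecomposition L x) (hL : IsNondegenerate L J)
    (v : (bsTree h).V) : ¬ (bsTree h).IsRedundant v := by
  by_cases hv : MulAction.stabilizer G v = ⊥
  · obtain ⟨o, g, rfl⟩ := exists_eq_vtx (L := L) v
    have hbot : L o = ⊥ := by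
      by_contra ho
      exact conj_ne_bot ho ((stabilizer_vtx L o g).symm.trans hv)
    match o with
    | some i => exact absurd hbot (hL.some_ne_bot i)
    | none =>
      -- A vertex with trivial stabilizer occurs only over a trivial base group. Then there are two
      -- loops, and `g (x j)`, `g (x j')`, `g (x j)⁻¹` give three distinct neighbours.
      obtain ⟨j, j', hjj'⟩ : ∃ j j' : J, j ≠ j' := by
        rcases hL.base with ⟨h0, -⟩ | ⟨-, -, hJ⟩
        · exact absurd hbot h0
        · exact exists_pair_ne J
      rintro ⟨hcard, -⟩
      obtain ⟨a, b, -, hab⟩ := Set.encard_eq_two.1 hcard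
      have hmem : ∀ w, (bsGraph L x).Adj (vtx L none g) w → w = a ∨ w = b := fun w hw => by
        have : w ∈ (bsTree h).graph.neighborSet (vtx L none g) := hw
        rw [hab] at this
        exact this
      have h1 := h.adj_tgt g (Sum.inr j)
      have h2 := h.adj_tgt g (Sum.inr j')
      have h3 := (h.adj_tgt (g * (x j)⁻¹) (Sum.inr j)).symm
      rw [show tgt L x (g * (x j)⁻¹) (Sum.inr j) = vtx L none g by simp [tgt]] at h3
      have n12 : tgt L x g (Sum.inr j) ≠ tgt L x g (Sum.inr j') := fun heq =>
        hjj' (Sum.inr.inj (h.label_unique (by rw [heq])).2)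
      have n3 : ∀ i : J, tgt L x g (Sum.inr i) ≠ vtx L none (g * (x j)⁻¹) := by
        intro i heq
        have := (h.label_unique (g := g) (e := Sum.inr i) (g' := g * (x j)⁻¹) (e' := Sum.inr j)
          (by rw [heq, Sym2.eq_swap, tgt, inv_mul_cancel_right])).1
        exact h.vtx_ne_tgt g (Sum.inr i) (by rw [heq, ← this])
      rcases hmem _ h1 with e1 | e1 <;> rcases hmem _ h2 with e2 | e2 <;>
        rcases hmem _ h3 with e3 | e3 <;>
        first
        | exact n12 (e1.trans e2.symm)
        | exact n3 _ (e1.trans e3.symm)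
        | exact n3 _ (e2.trans e3.symm)
  · obtain ⟨w, hw⟩ := h.exists_adj hL.nonempty v
    exact (bsTree_freeOnEdges h).not_isRedundant hw hv

theorem bsTree_minimal (h : IsFreeDecomposition L x) (hL : IsNondegenerate L J)
    (S : Set (bsTree h).V) (hS : ∀ (g : G), ∀ v ∈ S, g • v ∈ S)
    (hconn : ((bsTree h).graph.induce S).Connected) : S = Set.univ := by
  have htrans : ∀ (o : Option I) (g g' : G), vtx L o g ∈ S → vtx L o g' ∈ S := by
    intro o g g' hg
    have heq : (g' * g⁻¹) • vtx L o g = vtx L o g' := by simp [smul_vtx]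
    exact heq ▸ hS (g' * g⁻¹) _ hg
  have hfix : ∀ o, ∀ a ∈ L o, vtx L o a = vtx L o 1 := by
    intro o a ha
    rw [vtx_eq_iff]
    simpa using ha
  obtain ⟨⟨v, hv⟩⟩ := hconn.nonempty
  -- A nontrivial `a` in `L o` moves a neighbour of the vertex `L o` to a second neighbour. An
  -- invariant connected set containing one contains both, hence the vertex between them.
  have hmid : ∀ (o o' : Option I), L o ≠ ⊥ →
      (∀ g, (bsGraph L x).Adj (vtx L o' g) (vtx L o g)) → vtx L o' 1 ∈ S → vtx L o 1 ∈ S := by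
    intro o o' ho hadj hmem
    obtain ⟨a, ha, ha1⟩ := (Subgroup.bot_or_exists_ne_one _).resolve_left ho
    refine MetricGTree.mem_of_adj_adj hconn (a := vtx L o' 1) (b := vtx L o' a)
      hmem (htrans o' 1 a hmem) (hadj 1) ?_ ?_
    · rw [← hfix o a ha]
      exact (hadj a).symm
    · intro heq
      refine ha1 ((bsTree_freeOnEdges h).eq_one (a := vtx L o' 1) (b := vtx L o 1)
        (hadj 1).ne ?_ ?_)
      · exact (congrArg (vtx L o') (mul_one a)).trans heq.symm
      · exact (congrArg (vtx L o) (mul_one a)).trans (hfix o a ha)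
  have hbase : vtx L none 1 ∈ S := by
    obtain ⟨o, g, rfl⟩ := exists_eq_vtx (L := L) v
    match o with
    | none => exact htrans none g 1 hv
    | some i =>
      rcases hL.base with ⟨h0, -⟩ | ⟨-, hI, -⟩
      · exact hmid none (some i) h0 (fun g => (h.adj_tgt g (Sum.inl i)).symm)
          (htrans _ g 1 hv)
      · exact hI.elim i
  refine Set.eq_univ_of_forall fun w => ?_
  obtain ⟨o, g, rfl⟩ := exists_eq_vtx (L := L) w
  match o with
  | none => exact htrans none 1 g hbase
  | some i => exact htrans _ 1 g (hmid (some i) none (hL.some_ne_bot i)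
      (fun g => h.adj_tgt g (Sum.inl i)) hbase)

/-- The orbit of the edges with label `e`. -/
def bsOrbit (h : IsFreeDecomposition L x) (e : I ⊕ J) : (bsTree h).EdgeOrbit :=
  (bsTree h).edgeOrbit ⟨(vtx L none 1, tgt L x 1 e), h.adj_tgt 1 e⟩

theorem edgeOrbit_eq_bsOrbit_iff (h : IsFreeDecomposition L x) (d : (bsTree h).OrientedEdge)
    (e : I ⊕ J) : (bsTree h).edgeOrbit d = bsOrbit h e ↔
      ∃ g, d.edge = s(vtx L none g, tgt L x g e) := by
  have key : ∀ g : G, Sym2.map (g • ·) s(vtx L none 1, tgt L x 1 e) =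
      s(vtx L none g, tgt L x g e) := fun g => by
    rw [Sym2.map_mk, smul_vtx, smul_tgt, mul_one]
  constructor
  · intro heq
    obtain ⟨g, hg⟩ := Quotient.exact heq.symm
    exact ⟨g, hg.symm.trans (key g)⟩
  · rintro ⟨g, hg⟩
    have : (bsTree h).edgeOrbitSetoid ⟨(vtx L none 1, tgt L x 1 e), h.adj_tgt 1 e⟩ d :=
      ⟨g, (key g).trans hg.symm⟩
    exact (Quotient.sound this).symm

theorem exists_edgeOrbit_eq (h : IsFreeDecomposition L x) (d : (bsTree h).OrientedEdge) :
    ∃ e, (bsTree h).edgeOrbit d = bsOrbit h e := by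
  obtain ⟨g, e, heq⟩ := h.adj_iff.1 d.adj
  exact ⟨e, (edgeOrbit_eq_bsOrbit_iff h d e).2 ⟨g, heq⟩⟩

theorem bsTree_inOuterSpace [Finite I] [Finite J] (h : IsFreeDecomposition L x)
    (hL : IsNondegenerate L J) {p : ℕ} {H : Fin p → Subgroup G} (hLH : SameFactors L H)
    (hH : ∀ i, H i ≠ ⊥) : (bsTree h).InOuterSpace H where
  no_redundant := bsTree_not_isRedundant h hL
  nontrivial := h.no_global_fixed hL
  minimal := bsTree_minimal h hL
  edge_stabilizer := bsTree_edge_stabilizer h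
  finite_edgeOrbit := by
    refine Finite.of_surjective (bsOrbit h) fun o => ?_
    induction o using Quotient.inductionOn with
    | _ d =>
      obtain ⟨e, he⟩ := exists_edgeOrbit_eq h d
      exact ⟨e, he.symm⟩
  existsUnique_fixed := fun i g => by
    obtain ⟨o, ho⟩ := hLH.exists_eq i
    have hne := hH i
    rw [ho] at hne ⊢
    refine ⟨vtx L o g, fun a ha => ?_, fun v hv => h.vtx_eq_of_fixed hne hv⟩
    rwa [← stabilizer_vtx] at ha
  vertex_stabilizer := fun v => by
    obtain ⟨o, g, rfl⟩ := exists_eq_vtx (L := L) v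
    have hst := stabilizer_vtx L o g
    rcases hLH.eq_bot_or o with ho | ⟨i, hi⟩
    · left
      rw [ho, conj_bot] at hst
      exact hst
    · right
      exact ⟨i, g, by rw [hi]; exact hst⟩

end OuterSpace

/-! ### Weak representatives and their irreducibility. -/

section WeakRepresentatives

variable {G : Type u} [Group G] {I J : Type} {L : Option I → Subgroup G} {x : J → G}

theorem exists_equivariant {X : Type u} [MulAction G X] (φ : G →* G) (w : Option I → X)
    (hw : ∀ o, ∀ g ∈ L o, φ g • w o = w o) :
    ∃ F : BSVertex L → X, ∀ o g, F (vtx L o g) = φ g • w o := by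
  have hwd : ∀ o (a b : G), (QuotientGroup.leftRel (L o)) a b → φ a • w o = φ b • w o := by
    intro o a b hab
    rw [QuotientGroup.leftRel_apply] at hab
    have := hw o _ hab
    rw [map_mul, mul_smul, map_inv, inv_smul_eq_iff] at this
    exact this.symm
  exact ⟨fun v => Quotient.lift (fun g => φ g • w v.1) (hwd v.1) v.2, fun o g => rfl⟩

/-- Images of the orbit representatives may be chosen freely, subject to being fixed by `φ (L o)`;
edges then go to geodesics. -/
theorem exists_weakRepresentative (h : IsFreeDecomposition L x) (φ : G →* G)
    (w : Option I → BSVertex L) (hw : ∀ o, ∀ g ∈ L o, φ g • w o = w o) :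
    ∃ f : WeakRepresentative (bsTree h) φ, ∀ o g, f.toFun (vtx L o g) = φ g • w o := by
  obtain ⟨F, hF⟩ := exists_equivariant φ w hw
  refine ⟨⟨F, fun g v => ?_, fun {v w} _ => (bsTree h).geodesic (F v) (F w),
    fun {v w} _ => (bsTree h).geodesic_isPath _ _⟩, hF⟩
  obtain ⟨o, g', rfl⟩ := exists_eq_vtx (L := L) v
  exact (hF o (g * g')).trans (by rw [hF, map_mul, mul_smul]; rfl)

/-- Collapsing the edges with label in `S`. -/
theorem exists_collapse (L : Option I → Subgroup G) (x : J → G) (S : Set (I ⊕ J)) :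
    ∃ κ : BSVertex L → BSVertex (mergedFactors L x S),
      (∀ (g : G) v, κ (g • v) = g • κ v) ∧ ∀ e ∈ S, κ (tgt L x 1 e) = κ (vtx L none 1) := by
  classical
  let w : Option I → BSVertex (mergedFactors L x S) := fun o => match o with
    | none => vtx _ none 1
    | some i => if hi : Sum.inl i ∈ S then vtx _ none 1 else vtx _ (some ⟨i, hi⟩) 1
  have hfix : ∀ o, ∀ g ∈ mergedFactors L x S o, g • vtx (mergedFactors L x S) o 1 =
      vtx (mergedFactors L x S) o 1 := by
    intro o g hg
    rw [← MulAction.mem_stabilizer_iff, stabilizer_vtx, mem_conj_iff]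
    simpa using hg
  have hw : ∀ o, ∀ g ∈ L o, MonoidHom.id G g • w o = w o := by
    intro o g hg
    match o with
    | none => exact hfix none g (none_le_factorSubgroup hg)
    | some i =>
      by_cases hi : Sum.inl i ∈ S
      · rw [show w (some i) = vtx _ none 1 from dif_pos hi]
        exact hfix none g (some_le_factorSubgroup hi hg)
      · rw [show w (some i) = vtx _ (some ⟨i, hi⟩) 1 from dif_neg hi]
        exact hfix (some ⟨i, hi⟩) g hg
  obtain ⟨κ, hκ⟩ := exists_equivariant (MonoidHom.id G) w hw
  refine ⟨κ, fun g v => ?_, fun e he => ?_⟩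
  · obtain ⟨o, g', rfl⟩ := exists_eq_vtx v
    rw [smul_vtx, hκ, hκ, MonoidHom.id_apply, MonoidHom.id_apply, mul_smul]
  · cases e with
    | inl i =>
      rw [tgt, hκ, hκ, show w (some i) = vtx _ none 1 from dif_pos he]
    | inr j =>
      rw [tgt, hκ, hκ, map_one, one_smul, one_mul]
      exact hfix none _ (mem_factorSubgroup he)

variable {h : IsFreeDecomposition L x} {φ : G →* G}

/-- Two functions agree along an edge if they do so along the representative of its orbit. -/
theorem eq_along_edge {T : MetricGTree G} {X : Type u} [MulAction G X] {F : T.V → X}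
    (hF : ∀ (g : G) v, F (g • v) = φ g • F v) {d : T.OrientedEdge}
    (hd : F (T.edgeRep (T.edgeOrbit d)).fst = F (T.edgeRep (T.edgeOrbit d)).snd) :
    F d.fst = F d.snd := by
  obtain ⟨g, hg⟩ : T.edgeOrbitSetoid (T.edgeRep (T.edgeOrbit d)) d :=
    Quotient.exact (Quotient.out_eq (T.edgeOrbit d))
  set r := T.edgeRep (T.edgeOrbit d)
  have hg' : s(g • r.fst, g • r.snd) = s(d.fst, d.snd) := hg
  rw [Sym2.eq_iff] at hg'
  rcases hg' with ⟨h1, h2⟩ | ⟨h1, h2⟩ <;> rw [← h1, ← h2, hF, hF, hd]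

theorem WeakRepresentative.transitionMatrix_pos {T : MetricGTree G} (f : WeakRepresentative T φ)
    {j : T.EdgeOrbit} {d : T.OrientedEdge} (hd : d ∈ (f.edgePath (T.edgeRep j).adj).darts) :
    0 < f.transitionMatrix (T.edgeOrbit d) j := by
  classical
  simp only [transitionMatrix, Matrix.of_apply, Nat.cast_pos]
  exact List.countP_pos_iff.2 ⟨d, hd, by simp⟩

theorem WeakRepresentative.exists_dart {T : MetricGTree G} (f : WeakRepresentative T φ)
    {i j : T.EdgeOrbit} (hij : 0 < f.transitionMatrix i j) :
    ∃ d, d ∈ (f.edgePath (T.edgeRep j).adj).darts := by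
  classical
  simp only [transitionMatrix, Matrix.of_apply, Nat.cast_pos] at hij
  obtain ⟨d, hd, -⟩ := List.countP_pos_iff.1 hij
  exact ⟨d, hd⟩

theorem eq_of_walk {V X : Type*} {Γ : SimpleGraph V} (F : V → X) {v w : V} (p : Γ.Walk v w)
    (hp : ∀ d ∈ p.darts, F d.fst = F d.snd) : F v = F w := by
  induction p with
  | nil => rfl
  | cons hadj p ih =>
    rw [SimpleGraph.Walk.darts_cons] at hp
    exact (hp _ List.mem_cons_self).trans (ih fun d hd => hp d (List.mem_cons_of_mem _ hd))

/-- A set of orbits of edges is invariant if the images of its edges cross only its edges. -/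
def WeakRepresentative.IsInvariantSet {T : MetricGTree G} (f : WeakRepresentative T φ)
    (𝒮 : Set T.EdgeOrbit) : Prop :=
  ∀ j ∈ 𝒮, ∀ i, 0 < f.transitionMatrix i j → i ∈ 𝒮

/-- After collapsing the edges in the invariant set, `f` becomes constant along those edges. The
merged factor thus sends the base vertex to itself in the collapsed tree, so its `φ`-image lies in a
vertex stabilizer there. -/
theorem map_factorSubgroup_le {f : WeakRepresentative (bsTree h) φ}
    {𝒮 : Set (bsTree h).EdgeOrbit} (h𝒮 : f.IsInvariantSet 𝒮) :
    ∃ o g, (factorSubgroup L x (bsOrbit h ⁻¹' 𝒮)).map φ ≤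
      conj g (mergedFactors L x (bsOrbit h ⁻¹' 𝒮) o) := by
  set S := bsOrbit h ⁻¹' 𝒮
  obtain ⟨κ, hκ, hκS⟩ := exists_collapse L x S
  have hκd : ∀ d : (bsTree h).OrientedEdge, (bsTree h).edgeOrbit d ∈ 𝒮 → κ d.fst = κ d.snd := by
    intro d hd
    obtain ⟨e, he⟩ := exists_edgeOrbit_eq h d
    obtain ⟨g, hg⟩ := (edgeOrbit_eq_bsOrbit_iff h d e).1 he
    have heS : e ∈ S := by rwa [he] at hd
    have hge : κ (tgt L x g e) = κ (vtx L none g) := by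
      have h1 := smul_tgt L x g 1 e
      have h2 := smul_vtx L g none 1
      rw [mul_one] at h1 h2
      rw [← h1, ← h2, hκ, hκ, hκS e heS]
    have hg' : s(d.fst, d.snd) = s(vtx L none g, tgt L x g e) := hg
    rcases Sym2.eq_iff.1 hg' with ⟨h1, h2⟩ | ⟨h1, h2⟩
    · exact (congrArg κ h1).trans (hge.symm.trans (congrArg κ h2).symm)
    · exact (congrArg κ h1).trans (hge.trans (congrArg κ h2).symm)
  let F : BSVertex L → BSVertex (mergedFactors L x S) := fun v => κ (f.toFun v)
  have hF : ∀ (g : G) v, F (g • v) = φ g • F v := fun g v =>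
    (congrArg κ (f.map_smul g v)).trans (hκ _ _)
  have hFd : ∀ d : (bsTree h).OrientedEdge, (bsTree h).edgeOrbit d ∈ 𝒮 → F d.fst = F d.snd := by
    intro d hd
    refine eq_along_edge (T := bsTree h) hF ?_
    refine eq_of_walk κ (f.edgePath ((bsTree h).edgeRep _).adj) fun d' hd' => hκd d' ?_
    exact h𝒮 _ hd _ (f.transitionMatrix_pos hd')
  have hFe : ∀ e ∈ S, F (tgt L x 1 e) = F (vtx L none 1) := fun e he =>
    (hFd ⟨(vtx L none 1, tgt L x 1 e), h.adj_tgt 1 e⟩ he).symm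
  have hle : factorSubgroup L x S ≤
      (MulAction.stabilizer G (F (vtx L none 1))).comap φ := by
    refine factorSubgroup_le (fun a ha => ?_) (fun i hi a ha => ?_) fun j hj => ?_ <;>
      rw [Subgroup.mem_comap, MulAction.mem_stabilizer_iff, ← hF]
    · congr 1
      rw [smul_vtx, eq_comm, vtx_eq_iff]
      simpa using ha
    · rw [hF, ← hFe _ hi, ← hF]
      congr 1
      rw [tgt, smul_vtx, eq_comm, vtx_eq_iff]
      simpa using ha
    · rw [← hFe _ hj, smul_vtx, tgt, one_mul, mul_one]
  obtain ⟨o, g, hog⟩ := exists_eq_vtx (F (vtx L none 1))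
  refine ⟨o, g, ?_⟩
  rw [← stabilizer_vtx, ← hog]
  exact Subgroup.map_le_iff_le_comap.2 hle

theorem not_isInvariantSet [Finite I] [Finite J] (hL : IsNondegenerate L J) {p : ℕ}
    {H : Fin p → Subgroup G} (hLH : SameFactors L H) (hH : ∀ i, H i ≠ ⊥)
    (hirr : IsIrreducibleRel φ H) (f : WeakRepresentative (bsTree h) φ)
    {𝒮 : Set (bsTree h).EdgeOrbit} (hne : 𝒮.Nonempty) (huniv : 𝒮 ≠ Set.univ) :
    ¬ f.IsInvariantSet 𝒮 := by
  intro h𝒮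
  have hex := map_factorSubgroup_le h𝒮
  set S := bsOrbit h ⁻¹' 𝒮
  obtain ⟨o₁, g₁, hmap⟩ := hex
  have hsurj : ∀ i : (bsTree h).EdgeOrbit, ∃ e, i = bsOrbit h e := fun i => by
    induction i using Quotient.inductionOn with
    | _ d => exact exists_edgeOrbit_eq h d
  have hSne : S.Nonempty := by
    obtain ⟨i, hi⟩ := hne
    obtain ⟨e, rfl⟩ := hsurj i
    exact ⟨e, hi⟩
  obtain ⟨e₀, he₀⟩ : ∃ e, e ∉ S := by
    by_contra! hall
    refine huniv (Set.eq_univ_of_forall fun i => ?_)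
    obtain ⟨e, rfl⟩ := hsurj i
    exact hall e
  have hL_le : ∀ o, ∃ o', L o ≤ mergedFactors L x S o' := by
    intro o
    match o with
    | none => exact ⟨none, none_le_factorSubgroup⟩
    | some i =>
      by_cases hi : Sum.inl i ∈ S
      · exact ⟨none, some_le_factorSubgroup hi⟩
      · exact ⟨some ⟨i, hi⟩, le_rfl⟩
  have hx_ne : ∀ j, x j ≠ 1 := fun j hj => h.vtx_ne_tgt 1 (Sum.inr j) (by simp [tgt, hj])
  obtain ⟨q, ⟨e⟩⟩ := Finite.exists_equiv_fin (Option {i : I // Sum.inl i ∉ S})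
  obtain ⟨l, ⟨e'⟩⟩ := Finite.exists_equiv_fin {j : J // Sum.inr j ∉ S}
  have hB0 : ∀ o, mergedFactors L x S o ≠ ⊥ := by
    intro o
    match o with
    | some i => exact hL.some_ne_bot i
    | none =>
      intro hbot
      obtain ⟨e, he⟩ := hSne
      cases e with
      | inl i => exact hL.some_ne_bot i (le_bot_iff.1 ((some_le_factorSubgroup he).trans hbot.le))
      | inr j => exact hx_ne j (Subgroup.mem_bot.1 (hbot.le (mem_factorSubgroup he)))
  have hmap' : ∀ o, ∃ o' g, (mergedFactors L x S o).map φ ≤ conj g (mergedFactors L x S o') := by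
    intro o
    match o with
    | none => exact ⟨o₁, g₁, hmap⟩
    | some i =>
      obtain ⟨i', hi'⟩ := (hLH.eq_bot_or (some i)).resolve_left (hL.some_ne_bot i)
      obtain ⟨j, g, hj⟩ := hirr.1 i'
      obtain ⟨o, ho⟩ := hLH.exists_eq j
      obtain ⟨o', ho'⟩ := hL_le o
      refine ⟨o', g, ?_⟩
      change (L (some i)).map φ ≤ _
      rw [← hi']
      exact hj.trans (conj_mono (ho.trans_le ho'))
  have hcases := hirr.2 q (mergedFactors L x S ∘ e.symm)
    ⟨fun i => hB0 _, l, _, ((h.merge S).reindex e.symm e'.symm).isFreeProduct⟩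
    (fun i => by
      obtain ⟨o, ho⟩ := hLH.exists_eq i
      obtain ⟨o', ho'⟩ := hL_le o
      refine ⟨e o', 1, ?_⟩
      rw [ho]
      intro a ha
      rw [mem_conj_iff]
      simpa using ho' ha)
    (fun i => by
      obtain ⟨o', g, ho'⟩ := hmap' (e.symm i)
      exact ⟨e o', g, by simpa using ho'⟩)
  rcases hcases with hcar | ⟨j, hj⟩
  · obtain ⟨i, g, hi⟩ := hcar (e none)
    obtain ⟨o, ho⟩ := hLH.exists_eq i
    have hle : factorSubgroup L x S ≤ conj g (L o) := by
      have := hi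
      rw [Function.comp_apply, Equiv.symm_apply_apply, ho] at this
      exact this
    rcases hL.base with ⟨h0, -⟩ | ⟨h0, hI, -⟩
    · refine h.not_fixed hL.some_ne_bot h0 hSne (vtx L o g) fun a ha => ?_
      rw [← MulAction.mem_stabilizer_iff, stabilizer_vtx]
      exact hle ha
    · match o with
      | none => exact hH i (ho.trans h0)
      | some i => exact hI.elim i
  · have htop : mergedFactors L x S (e.symm j) = ⊤ := hj
    match hej : e.symm j with
    | some i =>
      rw [hej] at htop
      refine h.no_global_fixed hL ⟨vtx L (some i) 1, fun g => ?_⟩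
      rw [← MulAction.mem_stabilizer_iff, stabilizer_vtx, mem_conj_iff]
      change L (some i) = ⊤ at htop
      simp [htop]
    | none =>
      rw [hej] at htop
      change factorSubgroup L x S = ⊤ at htop
      -- `F` kills every factor and generator except the one labelled `e₀`, which it keeps. As `e₀ ∉
      -- S`, `F` kills the merged factor; were that all of `G`, `F` would be trivial.
      classical
      obtain ⟨F, hFL, hFx⟩ := h.exists_lift G
        (fun o => if ∃ i, o = some i ∧ Sum.inl i = e₀ then (L o).subtype else 1)
        (fun j => if Sum.inr j = e₀ then x j else 1)
      have hker : F.ker = ⊤ := by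
        rw [eq_top_iff, ← htop]
        refine factorSubgroup_le (fun a ha => ?_) (fun i hi a ha => ?_) fun j hj => ?_
        · rw [MonoidHom.mem_ker, hFL none ⟨a, ha⟩, if_neg (by simp)]
          rfl
        · rw [MonoidHom.mem_ker, hFL (some i) ⟨a, ha⟩, if_neg]
          · rfl
          · rintro ⟨i', hii', rfl⟩
            rw [Option.some_inj] at hii'
            exact he₀ (hii' ▸ hi)
        · rw [MonoidHom.mem_ker, hFx, if_neg]
          rintro rfl
          exact he₀ hj
      have hF1 : ∀ g, F g = 1 := fun g => (hker ▸ Subgroup.mem_top g : g ∈ F.ker)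
      cases e₀ with
      | inl i =>
        obtain ⟨a, ha, ha1⟩ := (Subgroup.bot_or_exists_ne_one _).resolve_left (hL.some_ne_bot i)
        have := hFL (some i) ⟨a, ha⟩
        rw [if_pos ⟨i, rfl, rfl⟩, hF1] at this
        exact ha1 this.symm
      | inr j =>
        have := hFx j
        rw [if_pos rfl, hF1] at this
        exact hx_ne j this.symm

/-- The map does not collapse the whole tree. -/
theorem exists_not_collapsed (hL : IsNondegenerate L J) {p : ℕ}
    {H : Fin p → Subgroup G} (hLH : SameFactors L H) (hφ : Function.Injective φ)
    (htype : IsStrictlyTypePreserving φ H) (f : WeakRepresentative (bsTree h) φ) :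
    ∃ d : (bsTree h).OrientedEdge, f.toFun d.fst ≠ f.toFun d.snd := by
  by_contra! hall
  have hconst : ∀ v w, f.toFun v = f.toFun w := by
    intro v w
    obtain ⟨p⟩ := (bsTree h).isTree.connected.preconnected v w
    exact eq_of_walk f.toFun p fun d _ => hall d
  have hnot := h.no_global_fixed hL
  have hsub : ∀ hG : ∀ g : G, g = 1, False := fun hG =>
    hnot ⟨vtx L none 1, fun g => by rw [hG g, one_smul]⟩
  obtain ⟨o, g, hog⟩ := exists_eq_vtx (L := L) (f.toFun (vtx L none 1))
  have hφg : ∀ a, φ a ∈ conj g (L o) := by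
    intro a
    rw [← stabilizer_vtx, MulAction.mem_stabilizer_iff, ← hog]
    exact (f.map_smul a _).symm.trans (hconst _ _)
  rcases hLH.eq_bot_or o with ho | ⟨i, hi⟩
  · refine hsub fun a => hφ ?_
    have := hφg a
    rw [ho, conj_bot, Subgroup.mem_bot] at this
    rw [this, map_one]
  · have htop : (conj g (H i)).comap φ = ⊤ := by
      rw [eq_top_iff]
      intro a _
      rw [Subgroup.mem_comap, hi]
      exact hφg a
    rcases htype.2 i g with h1 | ⟨i', g', h1⟩
    · refine hsub fun a => ?_
      rw [← Subgroup.mem_bot, ← h1, htop]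
      trivial
    · obtain ⟨o', ho'⟩ := hLH.exists_eq i'
      refine hnot ⟨vtx L o' g', fun a => ?_⟩
      rw [← MulAction.mem_stabilizer_iff, stabilizer_vtx, ← ho', ← h1, htop]
      trivial

theorem WeakRepresentative.exists_pos_of_ne {T : MetricGTree G} (f : WeakRepresentative T φ)
    {d : T.OrientedEdge} (hd : f.toFun d.fst ≠ f.toFun d.snd) :
    ∃ i, 0 < f.transitionMatrix i (T.edgeOrbit d) := by
  by_contra! hcol
  refine hd (eq_along_edge f.map_smul (eq_of_walk id (f.edgePath (T.edgeRep _).adj) ?_))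
  intro d' hd'
  exact absurd (f.transitionMatrix_pos hd') (hcol _).not_gt

theorem bsTree_isIrreducible [Finite I] [Finite J] (hL : IsNondegenerate L J) {p : ℕ}
    {H : Fin p → Subgroup G} (hLH : SameFactors L H) (hH : ∀ i, H i ≠ ⊥)
    (hφ : Function.Injective φ) (htype : IsStrictlyTypePreserving φ H)
    (hirr : IsIrreducibleRel φ H) (f : WeakRepresentative (bsTree h) φ) : f.IsIrreducible := by
  have hinv : ∀ 𝒮 : Set (bsTree h).EdgeOrbit, 𝒮.Nonempty → f.IsInvariantSet 𝒮 →
      𝒮 = Set.univ := fun 𝒮 hne h𝒮 => by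
    by_contra huniv
    exact not_isInvariantSet hL hLH hH hirr f hne huniv h𝒮
  refine ⟨fun i j => Nat.cast_nonneg _, fun i j => ?_⟩
  let := f.transitionMatrix.toQuiver
  -- The orbits crossed by iterated images of `j`, an invariant set. If it is empty, column `j`
  -- vanishes, so `{j}` is invariant, hence is everything, and `f` collapses the whole tree.
  let 𝒮 : Set (bsTree h).EdgeOrbit := {i | ∃ p : Quiver.Path i j, 0 < p.length}
  have h𝒮 : f.IsInvariantSet 𝒮 := by
    rintro k ⟨p, hp⟩ i hik
    exact ⟨(Quiver.Hom.toPath (⟨hik⟩ : i ⟶ k)).comp p, by simp⟩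
  have hne : 𝒮.Nonempty := by
    by_contra hempty
    have hcol : ∀ i, ¬ 0 < f.transitionMatrix i j := fun i hij =>
      hempty ⟨i, Quiver.Hom.toPath (⟨hij⟩ : i ⟶ j), by simp⟩
    have hj := hinv {j} ⟨j, rfl⟩ (by
      rintro _ rfl i hi
      exact absurd hi (hcol i))
    obtain ⟨d, hd⟩ := exists_not_collapsed hL hLH hφ htype f
    obtain ⟨i, hi⟩ := f.exists_pos_of_ne hd
    have hdj : (bsTree h).edgeOrbit d ∈ ({j} : Set _) := hj ▸ Set.mem_univ _
    rw [Set.mem_singleton_iff.1 hdj] at hi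
    exact hcol i hi
  exact (hinv 𝒮 hne h𝒮 ▸ Set.mem_univ i : i ∈ 𝒮)

/-- By tightness a collapsed edge has the empty path as image, hence a zero column in the transition
matrix. -/
theorem WeakRepresentative.IsIrreducible.ne_of_adj {T : MetricGTree G}
    {f : WeakRepresentative T φ} (hf : f.IsIrreducible) {v w : T.V} (hvw : T.graph.Adj v w) :
    f.toFun v ≠ f.toFun w := by
  intro heq
  let := f.transitionMatrix.toQuiver
  let d : T.OrientedEdge := ⟨(v, w), hvw⟩
  obtain ⟨p, hp⟩ := hf.connected (T.edgeOrbit d) (T.edgeOrbit d)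
  obtain ⟨i, hi⟩ : ∃ i, 0 < f.transitionMatrix i (T.edgeOrbit d) := by
    cases p with
    | nil => simp at hp
    | cons p e => exact ⟨_, e.down⟩
  obtain ⟨d', hd'⟩ := f.exists_dart hi
  obtain ⟨g, hg⟩ : T.edgeOrbitSetoid d (T.edgeRep (T.edgeOrbit d)) :=
    Quotient.exact (Quotient.out_eq (T.edgeOrbit d)).symm
  set r := T.edgeRep (T.edgeOrbit d)
  have hr : f.toFun r.fst = f.toFun r.snd := by
    have hg' : s(g • v, g • w) = s(r.fst, r.snd) := hg
    rw [Sym2.eq_iff] at hg'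
    rcases hg' with ⟨h1, h2⟩ | ⟨h1, h2⟩ <;> rw [← h1, ← h2, f.map_smul, f.map_smul, heq]
  have hpath := f.tight r.adj
  generalize f.edgePath r.adj = p' at hpath hd'
  revert p'
  rw [hr]
  intro p' hpath hd'
  rw [(SimpleGraph.Walk.isPath_iff_nil.1 hpath).eq_nil] at hd'
  simp at hd'

end WeakRepresentatives

/-! ### Existence of two gates at each vertex. -/

section Gates

variable {G : Type u} [Group G] {φ : G →* G}

theorem WeakRepresentative.gate_iff {T : MetricGTree G} (f : WeakRepresentative T φ) {v : T.V}
    (w w' : T.graph.neighborSet v) : f.gate v w w' ↔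
      T.next (f.toFun v) (f.toFun w) = T.next (f.toFun v) (f.toFun w') := by
  rw [gate, MetricGTree.eq_geodesic (f.tight w.2), MetricGTree.eq_geodesic (f.tight w'.2)]
  rfl

theorem WeakRepresentative.isTrainTrackStructure {T : MetricGTree G}
    (f : WeakRepresentative T φ)
    (hf : ∀ v, ∃ w w', T.graph.Adj v w ∧ T.graph.Adj v w' ∧
      T.next (f.toFun v) (f.toFun w) ≠ T.next (f.toFun v) (f.toFun w')) :
    T.IsTrainTrackStructure f.gate where
  equivalence v := ⟨fun _ => rfl, fun h => h.symm, fun h h' => h.trans h'⟩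
  smul g v w w' hww' := by
    rw [gate_iff] at hww' ⊢
    simp only [f.map_smul, MetricGTree.next_smul, hww']
  two_gates v := by
    obtain ⟨w, w', hw, hw', hne⟩ := hf v
    exact ⟨⟨w, hw⟩, ⟨w', hw'⟩, fun h => hne ((f.gate_iff _ _).1 h)⟩

/-- A vertex with nontrivial stabilizer has at least two gates. -/
theorem WeakRepresentative.exists_gates_of_stabilizer {T : MetricGTree G}
    {f : WeakRepresentative T φ} (hf : f.IsIrreducible) (hT : T.FreeOnEdges)
    (hφ : Function.Injective φ) {v w : T.V} (hv : MulAction.stabilizer G v ≠ ⊥)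
    (hvw : T.graph.Adj v w) :
    ∃ w w', T.graph.Adj v w ∧ T.graph.Adj v w' ∧
      T.next (f.toFun v) (f.toFun w) ≠ T.next (f.toFun v) (f.toFun w') := by
  obtain ⟨a, ha, ha1⟩ := (Subgroup.bot_or_exists_ne_one _).resolve_left hv
  rw [MulAction.mem_stabilizer_iff] at ha
  refine ⟨w, a • w, hvw, ?_, fun heq => ha1 (hφ ?_)⟩
  · have := T.adj_smul a v w hvw
    rwa [ha] at this
  · have hfv : φ a • f.toFun v = f.toFun v := by rw [← f.map_smul, ha]
    rw [map_one]
    refine hT.eq_one (T.adj_next (hf.ne_of_adj hvw)).ne hfv ?_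
    rw [← T.next_smul, hfv, ← f.map_smul, heq]

theorem MetricGTree.length_geodesic (T : MetricGTree G) (a b : T.V) :
    (T.geodesic a b).length = T.graph.dist a b := by
  obtain ⟨p, hp, hlen⟩ := T.isTree.connected.exists_path_of_dist a b
  rw [← eq_geodesic hp, hlen]

theorem dist_snd_penultimate_lt {V : Type*} {Γ : SimpleGraph V} {a b : V} (p : Γ.Walk a b)
    (hab : a ≠ b) :
    p.snd = b ∧ p.penultimate = a ∨ Γ.dist p.snd p.penultimate < p.length := by
  cases p with
  | nil => exact absurd rfl hab
  | cons hadj q =>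
    cases q with
    | nil => exact Or.inl ⟨rfl, rfl⟩
    | cons hadj' r =>
      right
      have hle := SimpleGraph.dist_le (SimpleGraph.Walk.cons hadj' r).dropLast
      have hlen : (SimpleGraph.Walk.cons hadj' r).dropLast.length ≤
          (SimpleGraph.Walk.cons hadj' r).length := by
        rw [← SimpleGraph.Walk.length_darts, SimpleGraph.Walk.darts_dropLast,
          List.length_dropLast, SimpleGraph.Walk.length_darts]
        omega
      rw [SimpleGraph.Walk.penultimate_cons_cons, SimpleGraph.Walk.snd_cons,
        SimpleGraph.Walk.length_cons]
      omega

/-- If the directions at `u` towards `t u` and `t⁻¹ u` agree, the displacement of `t` decreases in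
this direction. -/
theorem MetricGTree.FreeOnEdges.dist_lt {T : MetricGTree G} (hT : T.FreeOnEdges) {t : G}
    {u s : T.V} (hu : u ≠ t • u) (h1 : T.next u (t • u) = s)
    (h2 : T.next u (t⁻¹ • u) = s) : T.graph.dist s (t • s) < T.graph.dist u (t • u) := by
  have hrev : T.next (t • u) u = t • s := by
    have := T.next_smul t u (t⁻¹ • u)
    rwa [smul_inv_smul, h2] at this
  have hpen : (T.geodesic u (t • u)).penultimate = t • s := by
    rw [← SimpleGraph.Walk.snd_reverse, eq_geodesic (T.geodesic_isPath u (t • u)).reverse]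
    exact hrev
  have hadj := T.adj_next hu
  have key := dist_snd_penultimate_lt (T.geodesic u (t • u)) hu
  rw [hpen, T.length_geodesic, show (T.geodesic u (t • u)).snd = s from h1] at key
  refine key.resolve_left fun ⟨h3, h4⟩ => hu ?_
  rw [h1] at hadj
  -- The exceptional case: the path is a single edge inverted by `t`, and edge stabilizers are
  -- trivial even allowing inversions.
  have ht : t = 1 := hT ⟨(u, s), hadj⟩ t (by simp [SimpleGraph.Dart.edge, ← h3, h4])
  rw [ht, one_smul]

theorem exists_weakRepresentative_two_gates {J : Type} [Finite J] [Nonempty J]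
    {L : Option (Fin 0) → Subgroup G} {x : J → G} (h : IsFreeDecomposition L x)
    (hL : ∀ o, L o = ⊥)
    (hirr : ∀ f : WeakRepresentative (bsTree h) φ, f.IsIrreducible) :
    ∃ f : WeakRepresentative (bsTree h) φ, (bsTree h).IsTrainTrackStructure f.gate := by
  have := Fintype.ofFinite J
  -- Natural-number valued, so a minimum is attained.
  let D : BSVertex L → ℕ := fun u => ∑ j, (bsGraph L x).dist u (φ (x j) • u)
  have : Nonempty (BSVertex L) := ⟨vtx L none 1⟩
  obtain ⟨u, hu⟩ : ∃ u, ∀ v, D u ≤ D v := ⟨Function.argmin D, fun v => Function.argmin_le D v⟩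
  obtain ⟨f, hf⟩ := exists_weakRepresentative h φ (fun _ => u) (fun o g hg => by
    rw [hL, Subgroup.mem_bot] at hg
    rw [hg, map_one, one_smul])
  refine ⟨f, f.isTrainTrackStructure fun v => ?_⟩
  obtain ⟨o, g, rfl⟩ := exists_eq_vtx (L := L) v
  match o with
  | some i => exact i.elim0
  | none =>
    by_contra! hall
    have hf' : ∀ y, f.toFun (vtx L none (g * y)) = φ g • φ y • u := fun y => by
      rw [hf, map_mul, mul_smul]
    have hadj : ∀ j, (bsGraph L x).Adj (vtx L none g) (vtx L none (g * x j)) := fun j =>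
      h.adj_tgt g (Sum.inr j)
    have hadj' : ∀ j, (bsGraph L x).Adj (vtx L none g) (vtx L none (g * (x j)⁻¹)) := fun j => by
      have := (h.adj_tgt (g * (x j)⁻¹) (Sum.inr j)).symm
      rwa [tgt, inv_mul_cancel_right] at this
    let N := (bsTree h).next
    have hN : ∀ y y', (bsGraph L x).Adj (vtx L none g) (vtx L none (g * y)) →
        (bsGraph L x).Adj (vtx L none g) (vtx L none (g * y')) →
        N u (φ y • u) = N u (φ y' • u) := by
      intro y y' hy hy'
      have := hall _ _ hy hy'
      rw [hf', hf', hf] at this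
      have h1 := (bsTree h).next_smul (φ g) u (φ y • u)
      have h2 := (bsTree h).next_smul (φ g) u (φ y' • u)
      exact MulAction.injective (φ g) (h1.symm.trans (this.trans h2))
    -- With one gate, the directions at `u` towards all `φ (x j) • u` and `φ (x j)⁻¹ • u` coincide.
    -- Moving `u` one step to `s` lowers every summand of `D`.
    let j₀ := Classical.arbitrary J
    let s := N u (φ (x j₀) • u)
    refine (hu s).not_gt (Finset.sum_lt_sum_of_nonempty Finset.univ_nonempty fun j _ => ?_)
    refine (bsTree_freeOnEdges h).dist_lt (fun heq => ?_) (hN _ _ (hadj j) (hadj j₀)) ?_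
    · refine (hirr f).ne_of_adj (hadj j) ?_
      rw [hf', hf]
      exact congrArg (φ g • ·) heq
    · rw [← map_inv]
      exact hN _ _ (hadj' j) (hadj j₀)

end Gates

end RelTrainTrack

/-! ### The theorem, split by whether there are any factors `H i`. -/

open RelTrainTrack in
theorem mainTheorem2 {G : Type u} [Group G] {p k : ℕ} (H : Fin p → Subgroup G) (x : Fin k → G)
    (hG : RelTrainTrack.IsFreeProduct H x) (hH : ∀ i, H i ≠ ⊥) (hpk : 2 ≤ p + k)
    (φ : G →* G) (hφ : Function.Injective φ)
    (htype : RelTrainTrack.IsStrictlyTypePreserving φ H)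
    (hirr : RelTrainTrack.IsIrreducibleRel φ H) :
    ∃ (T : RelTrainTrack.MetricGTree G) (f : RelTrainTrack.WeakRepresentative T φ),
      T.InOuterSpace H ∧ f.IsIrreducible ∧ T.IsTrainTrackStructure f.gate := by
  cases p with
  | zero =>
    have h := hG.isFreeDecomposition.extend_bot
    have : Nontrivial (Fin k) := Fin.nontrivial_iff_two_le.2 (by omega)
    have hL : IsNondegenerate (fun _ : Option (Fin 0) => (⊥ : Subgroup G)) (Fin k) :=
      ⟨fun i => i.elim0, Or.inr ⟨rfl, inferInstance, inferInstance⟩⟩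
    have hLH : SameFactors (fun _ : Option (Fin 0) => (⊥ : Subgroup G)) H :=
      ⟨fun i => i.elim0, fun _ => Or.inl rfl⟩
    have hirr' := bsTree_isIrreducible (h := h) hL hLH hH hφ htype hirr
    obtain ⟨f, hf⟩ := exists_weakRepresentative_two_gates h (fun _ => rfl) hirr'
    exact ⟨bsTree h, f, bsTree_inOuterSpace h hL hLH hH, hirr' f, hf⟩
  | succ n =>
    have h := hG.isFreeDecomposition.reindex (finSuccEquiv n).symm (Equiv.refl _)
    set L : Option (Fin n) → Subgroup G := H ∘ (finSuccEquiv n).symm with hLdef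
    have hL0 : ∀ o, L o ≠ ⊥ := fun o => hH _
    have hL : IsNondegenerate L (Fin k) := by
      refine ⟨fun i => hL0 _, Or.inl ⟨hL0 _, ?_⟩⟩
      rcases Nat.eq_zero_or_pos n with hn | hn
      · exact ⟨Sum.inr ⟨0, by omega⟩⟩
      · exact ⟨Sum.inl ⟨0, hn⟩⟩
    have hLH : SameFactors L H :=
      ⟨fun i => ⟨finSuccEquiv n i, by simp [hLdef]⟩, fun o => Or.inr ⟨_, rfl⟩⟩
    -- The group `φ (L o)` lies in a conjugate of some `H j`, so it fixes the corresponding vertex;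
    -- any such choice defines a suitable map.
    have hex : ∀ o, ∃ w : BSVertex L, ∀ g ∈ L o, φ g • w = w := by
      intro o
      obtain ⟨j, g, hj⟩ := hirr.1 ((finSuccEquiv n).symm o)
      obtain ⟨o', ho'⟩ := hLH.exists_eq j
      refine ⟨vtx L o' g, fun a ha => ?_⟩
      rw [← MulAction.mem_stabilizer_iff, stabilizer_vtx, ← ho']
      exact hj ⟨a, ha, rfl⟩
    choose w hw using hex
    obtain ⟨f, -⟩ := exists_weakRepresentative h φ w hw
    have hf := bsTree_isIrreducible hL hLH hH hφ htype hirr f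
    refine ⟨bsTree h, f, bsTree_inOuterSpace h hL hLH hH, hf,
      f.isTrainTrackStructure fun v => ?_⟩
    obtain ⟨v', hvv'⟩ := h.exists_adj hL.nonempty v
    refine WeakRepresentative.exists_gates_of_stabilizer hf (bsTree_freeOnEdges h) hφ ?_ hvv'
    obtain ⟨o, g, rfl⟩ := exists_eq_vtx (L := L) v
    exact ((stabilizer_vtx L o g).trans_ne (conj_ne_bot (hL0 o)))
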